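/- Let $\mathcal H$ and $\mathcal G$ be real Hilbert spaces, let $L\colon\mathcal H\to\mathcal G$ be a bounded linear operator with $0<\|L\|\le 1$ and adjoint $L^*$, and let $g\colon\mathcal G\to\,]-\infty,+\infty]$ be proper (not identically $+\infty$), lower semicontinuous and convex. Notation. $Q_{\mathcal H}=\|\cdot\|_{\mathcal H}^2/2$ and $Q_{\mathcal G}=\|\cdot\|_{\mathcal G}^2/2$; $\operatorname{dom} f=\{x : f(x)<+\infty\}$; $\operatorname{Argmin} f$ is the set of global minimizers of a proper function $f$; $f^*(u)=\sup_x(\langle x,u\rangle-f(x))$ is the conjugate of $f$; $(f\,\square\,h)(x)=\inf_z(f(z)+h(x-z))$ is the infimal convolution; $\operatorname{Fix}T$ is the set of fixed points of $T$; $\operatorname{prox}_g(y)$ is the unique minimizer of $z\mapsto g(z)+\frac12\|y-z\|^2$. For a bounded linear operator $T$ and a function $f$, $T\triangleright f$ denotes the infimal postcomposition $(T\triangleright f)(y)=\inf_{Tx=y}f(x)$, with $\inf\varnothing=+\infty$. It is called exact if for every $y\in T(\operatorname{dom} f)$ there is $x$ with $Tx=y$ and $(T\triangleright f)(y)=f(x)\in\,]-\infty,+\infty]$.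 The proximal composition and the proximal cocomposition of $g$ with $L$ are $$L\diamond g=\big((g^*\,\square\,Q_{\mathcal G})\circ L\big)^*-Q_{\mathcal H},\qquad L\bullet g=(L\diamond g^*)^*.$$ Then $L\diamond g$, $L\bullet g$ and $(g\,\square\,Q_{\mathcal G})\circ L$ are proper functions from $\mathcal H$ to $]-\infty,+\infty]$, $\operatorname{prox}_g$ is well defined on all of $\mathcal G$, and the following hold: 1. $L\diamond g=L^*\triangleright(g+Q_{\mathcal G})-Q_{\mathcal H}$, and the infimal postcomposition $L^*\triangleright(g+Q_{\mathcal G})$ is exact. 2. $\operatorname{dom}(L\diamond g)=L^*(\operatorname{dom} g)$. 3. $\operatorname{Argmin}(L\diamond g)=\operatorname{Fix}(L^*\circ\operatorname{prox}_g\circ L)$. 4. $(L\diamond g)\,\square\,Q_{\mathcal H}=Q_{\mathcal H}-(g^*\,\square\,Q_{\mathcal G})\circ L$. 5. $(L\bullet g)\,\square\,Q_{\mathcal H}=(g\,\square\,Q_{\mathcal G})\circ L$. 6. $L^{-1}(\operatorname{Argmin} g)\subset\operatorname{Argmin}(L\bullet g)=\operatorname{Argmin}\big((g\,\square\,Q_{\mathcal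 G})\circ L\big)$. -/

import Mathlib

noncomputable section

namespace HilbertConvex

variable {E F : Type*}
  [NormedAddCommGroup E] [InnerProductSpace ℝ E]
  [NormedAddCommGroup F] [InnerProductSpace ℝ F]

/-- The effective domain of an extended-real-valued function. -/
def dom (f : E → EReal) : Set E := {x | f x < ⊤}

/-- `f` takes its values in `]-∞, +∞]` and is not identically `+∞`. -/
def IsProper (f : E → EReal) : Prop := (∀ x, f x ≠ ⊥) ∧ (dom f).Nonempty

/-- The epigraph of `f`, a subset of `E × ℝ`. -/
def epigraph (f : E → EReal) : Set (E × ℝ) := {p | f p.1 ≤ (p.2 : EReal)}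

/-- The class `Γ₀(E)` of proper lower semicontinuous convex functions `E → ]-∞, +∞]`
(a function is convex when its epigraph is). -/
structure IsGammaZero (f : E → EReal) : Prop where
  proper : IsProper f
  lsc : LowerSemicontinuous f
  convex : Convex ℝ (epigraph f)

variable (E) in
/-- The canonical quadratic form `‖·‖² / 2`. -/
def halfSq : E → EReal := fun x => ((‖x‖ ^ 2 / 2 : ℝ) : EReal)

/-- The conjugate `f* (u) = sup_x (⟪x, u⟫ - f x)`. -/
def conj (f : E → EReal) : E → EReal :=
  fun u => ⨆ x, ((inner ℝ x u : ℝ) : EReal) - f x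

/-- The infimal convolution of two functions with values in `]-∞, +∞]`. -/
def infConv (f g : E → EReal) : E → EReal := fun x => ⨅ z, f z + g (x - z)

/-- The infimal postcomposition of `f` by the linear operator `T`
(equal to `+∞` outside the range of `T`). -/
def postcomp (T : E →L[ℝ] F) (f : E → EReal) : F → EReal :=
  fun y => ⨅ x ∈ T ⁻¹' {y}, f x

/-- The infimal postcomposition of `f` by `T` is exact: over `T (dom f)` the infimum is attained,
with a value in `]-∞, +∞]`. -/
def IsExactPostcomp (T : E →L[ℝ] F) (f : E → EReal) : Prop :=
  ∀ y ∈ T '' dom f, ∃ x, T x = y ∧ postcomp T f y = f x ∧ f x ≠ ⊥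

/-- The set of global minimizers. -/
def Argmin (f : E → EReal) : Set E := {x | ∀ z, f x ≤ f z}

open Classical in
/-- The unique global minimizer, when there is exactly one (and `0` otherwise). -/
def argmin (f : E → EReal) : E := if h : ∃ x, Argmin f = {x} then h.choose else 0

/-- The function `z ↦ f z + ‖x - z‖² / 2` that defines the proximity operator at `x`. -/
def proxObjective (f : E → EReal) (x : E) : E → EReal := fun z => f z + halfSq E (x - z)

/-- The proximity operator of `f`. -/
def prox (f : E → EReal) : E → E := fun x => argmin (proxObjective f x)

/-- The proximal composition `L ▷ g = ((g* □ Q) ∘ L)* - Q`. -/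
def proxComp (L : E →L[ℝ] F) (g : F → EReal) : E → EReal :=
  conj (infConv (conj g) (halfSq F) ∘ L) - halfSq E

/-- The proximal cocomposition `L ◁ g = (L ▷ g*)*`. -/
def proxCocomp (L : E →L[ℝ] F) (g : F → EReal) : E → EReal := conj (proxComp L (conj g))

end HilbertConvex

end

/-! Everything except items 1 and 2 follows from one property, `HasProx`: every `x` splits as `p`
plus a subgradient of `f` at `p`. Such a split determines `prox f x`, both Moreau envelopes (of `f`
and of its conjugate) at `x`, and whether `x` is a minimizer. The property passes to conjugates by
swapping `p` and `x - p`, and to `proxComp L g` because `‖L‖ ≤ 1` (`IsSubgradientAt.proxComp`): if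
`p = prox g (L x)`, then `x - L* p` is a subgradient at `L* p`. For `g` in `Γ₀` it comes from
strongly convex minimization (`IsGammaZero.exists_isSubgradientAt`).

Items 1 and 2 need the value of the conjugate at every point: `conj_comp_le` gives one inequality,
and `exists_adjoint_eq` gives the other, with attainment, by penalizing the constraint `L* v = y`.
-/

noncomputable section

namespace HilbertConvex

open Filter Topology

/-! ### Subgradients, Moreau envelopes and minimizers -/

section Subgradient

variable {E F : Type*}
  [NormedAddCommGroup E] [InnerProductSpace ℝ E]
  [NormedAddCommGroup F] [InnerProductSpace ℝ F]

/-- `f p = a` is finite and `u` is a subgradient of `f` at `p`. -/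
def IsSubgradientAt (f : E → EReal) (p u : E) (a : ℝ) : Prop :=
  f p = (a : EReal) ∧ ∀ z, ((a + inner ℝ (z - p) u : ℝ) : EReal) ≤ f z

/-- Every `x` is the sum of a point `p` and of a subgradient of `f` at `p`. -/
def HasProx (f : E → EReal) : Prop := ∀ x, ∃ p a, IsSubgradientAt f p (x - p) a

lemma IsSubgradientAt.coe_le {f : E → EReal} {p u : E} {a : ℝ} (h : IsSubgradientAt f p u a)
    (z : E) {r : ℝ} (hr : f z ≤ (r : EReal)) : a + inner ℝ (z - p) u ≤ r := by
  exact_mod_cast (h.2 z).trans hr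

/-- Equality in Fenchel–Young, which is symmetric in `p` and `u`. -/
lemma IsSubgradientAt.conj {f : E → EReal} {p u : E} {a : ℝ} (h : IsSubgradientAt f p u a) :
    IsSubgradientAt (conj f) u p (inner ℝ p u - a) := by
  have hp : ∀ v, ((inner ℝ p v - a : ℝ) : EReal) ≤ HilbertConvex.conj f v := fun v => by
    refine le_trans (le_of_eq ?_) (le_iSup _ p)
    rw [h.1, EReal.coe_sub]
  refine ⟨le_antisymm (iSup_le fun z => ?_) (hp u), fun v => ?_⟩
  · refine (EReal.sub_le_sub le_rfl (h.2 z)).trans (le_of_eq ?_)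
    rw [← EReal.coe_sub, inner_sub_left]
    congr 1
    ring
  · refine le_trans (le_of_eq ?_) (hp v)
    rw [inner_sub_left, real_inner_comm p v, real_inner_comm p u]
    congr 1
    ring

lemma HasProx.conj {f : E → EReal} (h : HasProx f) : HasProx (conj f) := fun x => by
  obtain ⟨p, a, hp⟩ := h x
  refine ⟨x - p, inner ℝ p (x - p) - a, ?_⟩
  simpa using hp.conj

lemma HasProx.isProper {f : E → EReal} (h : HasProx f) : IsProper f := by
  obtain ⟨p, a, hp⟩ := h 0
  refine ⟨fun x hx => ?_, p, ?_⟩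
  · have := hp.2 x
    rw [hx, le_bot_iff] at this
    exact EReal.coe_ne_bot _ this
  · rw [dom, Set.mem_ofPred_eq, hp.1]
    exact EReal.coe_lt_top _

lemma half_norm_sq_sub_add_inner (x p z : E) :
    inner ℝ (z - p) (x - p) + ‖x - z‖ ^ 2 / 2 = ‖x - p‖ ^ 2 / 2 + ‖z - p‖ ^ 2 / 2 := by
  have h : x - z = (x - p) - (z - p) := by abel
  rw [h, norm_sub_sq_real (x - p) (z - p), real_inner_comm]
  ring

/-- The surplus `‖z - p‖ ^ 2 / 2` expresses strong convexity; it makes `p` the only minimizer. -/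
lemma IsSubgradientAt.le_proxObjective {f : E → EReal} {x p : E} {a : ℝ}
    (h : IsSubgradientAt f p (x - p) a) (z : E) :
    ((a + ‖x - p‖ ^ 2 / 2 + ‖z - p‖ ^ 2 / 2 : ℝ) : EReal) ≤ proxObjective f x z := by
  refine le_trans (le_of_eq ?_) (add_le_add_left (h.2 z) _)
  rw [halfSq, ← EReal.coe_add, add_assoc a (inner ℝ _ _), half_norm_sq_sub_add_inner, add_assoc]

lemma IsSubgradientAt.proxObjective_self {f : E → EReal} {x p : E} {a : ℝ}
    (h : IsSubgradientAt f p (x - p) a) :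
    proxObjective f x p = ((a + ‖x - p‖ ^ 2 / 2 : ℝ) : EReal) := by
  rw [proxObjective, h.1, halfSq, ← EReal.coe_add]

/-- The value of the Moreau envelope at `x`. -/
lemma IsSubgradientAt.infConv_halfSq {f : E → EReal} {x p : E} {a : ℝ}
    (h : IsSubgradientAt f p (x - p) a) :
    infConv f (halfSq E) x = ((a + ‖x - p‖ ^ 2 / 2 : ℝ) : EReal) := by
  refine le_antisymm ((iInf_le _ p).trans_eq h.proxObjective_self) (le_iInf fun z => ?_)
  refine le_trans ?_ (h.le_proxObjective z)
  exact_mod_cast le_add_of_nonneg_right (by positivity)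

/-- The value at `x` of the Moreau envelope of the conjugate. -/
lemma IsSubgradientAt.infConv_conj_halfSq {f : E → EReal} {x p : E} {a : ℝ}
    (h : IsSubgradientAt f p (x - p) a) :
    infConv (HilbertConvex.conj f) (halfSq E) x
      = ((inner ℝ p x - ‖p‖ ^ 2 / 2 - a : ℝ) : EReal) := by
  have h' : IsSubgradientAt (HilbertConvex.conj f) (x - p) (x - (x - p))
      (inner ℝ p (x - p) - a) := by simpa using h.conj
  rw [h'.infConv_halfSq, sub_sub_cancel, inner_sub_right, real_inner_self_eq_norm_sq]
  congr 1
  ring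

/-- Moreau's decomposition of `‖·‖² / 2`. -/
lemma HasProx.infConv_conj {f : E → EReal} (h : HasProx f) :
    infConv (HilbertConvex.conj f) (halfSq E) = halfSq E - infConv f (halfSq E) := by
  funext x
  obtain ⟨p, a, hp⟩ := h x
  rw [Pi.sub_apply, hp.infConv_conj_halfSq, hp.infConv_halfSq, halfSq, ← EReal.coe_sub,
    norm_sub_sq_real, real_inner_comm]
  congr 1
  ring

lemma HasProx.exists_infConv_eq {f : E → EReal} (h : HasProx f) (x : E) :
    ∃ r : ℝ, infConv f (halfSq E) x = (r : EReal) := by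
  obtain ⟨p, a, hp⟩ := h x
  exact ⟨_, hp.infConv_halfSq⟩

/-- Moreau's decomposition applied twice; this replaces the biconjugate theorem. -/
lemma HasProx.infConv_conj_conj {f : E → EReal} (h : HasProx f) :
    infConv (HilbertConvex.conj (HilbertConvex.conj f)) (halfSq E) = infConv f (halfSq E) := by
  funext x
  obtain ⟨r, hr⟩ := h.exists_infConv_eq x
  rw [h.conj.infConv_conj, h.infConv_conj, Pi.sub_apply, Pi.sub_apply, hr, halfSq,
    ← EReal.coe_sub, ← EReal.coe_sub, sub_sub_cancel]

lemma IsSubgradientAt.argmin_proxObjective {f : E → EReal} {x p : E} {a : ℝ}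
    (h : IsSubgradientAt f p (x - p) a) : Argmin (proxObjective f x) = {p} := by
  ext q
  rw [Set.mem_singleton_iff]
  constructor
  · intro hq
    have := (h.le_proxObjective q).trans ((hq p).trans_eq h.proxObjective_self)
    rw [EReal.coe_le_coe_iff] at this
    have h0 : ‖q - p‖ = 0 := by
      have := norm_nonneg (q - p)
      nlinarith
    exact sub_eq_zero.1 (norm_eq_zero.1 h0)
  · rintro rfl z
    rw [h.proxObjective_self]
    refine le_trans ?_ (h.le_proxObjective z)
    exact_mod_cast le_add_of_nonneg_right (by positivity)

lemma IsSubgradientAt.prox_eq {f : E → EReal} {x p : E} {a : ℝ}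
    (h : IsSubgradientAt f p (x - p) a) : prox f x = p := by
  have hex : ∃ q, Argmin (proxObjective f x) = {q} := ⟨p, h.argmin_proxObjective⟩
  have hc := hex.choose_spec
  rw [prox, argmin, dif_pos hex]
  exact (Set.singleton_injective (h.argmin_proxObjective.symm.trans hc)).symm

lemma IsSubgradientAt.mem_argmin_iff {f : E → EReal} {x p : E} {a : ℝ}
    (h : IsSubgradientAt f p (x - p) a) : x ∈ Argmin f ↔ p = x := by
  constructor
  · intro hx
    have := h.coe_le x ((hx p).trans_eq h.1)
    rw [real_inner_self_eq_norm_sq] at this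
    have h0 : ‖x - p‖ = 0 := by
      have := norm_nonneg (x - p)
      nlinarith
    exact (sub_eq_zero.1 (norm_eq_zero.1 h0)).symm
  · rintro rfl z
    simpa [h.1] using h.2 z

lemma IsSubgradientAt.mem_argmin_infConv_iff {f : E → EReal} {x p : E} {a : ℝ}
    (h : IsSubgradientAt f p (x - p) a) : x ∈ Argmin (infConv f (halfSq E)) ↔ p = x := by
  constructor
  · intro hx
    have hp : infConv f (halfSq E) p ≤ (a : EReal) := by
      refine (iInf_le _ p).trans_eq ?_
      simp [h.1, halfSq]
    have := (hx p).trans hp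
    rw [h.infConv_halfSq, EReal.coe_le_coe_iff] at this
    have h0 : ‖x - p‖ = 0 := by
      have := norm_nonneg (x - p)
      nlinarith
    exact (sub_eq_zero.1 (norm_eq_zero.1 h0)).symm
  · rintro rfl y
    rw [h.infConv_halfSq, sub_self, norm_zero]
    refine le_iInf fun z => ?_
    have hz := h.2 z
    rw [sub_self, inner_zero_right] at hz
    refine le_trans (le_of_eq ?_) (add_le_add hz
      (EReal.coe_le_coe_iff.2 (show (0 : ℝ) ≤ ‖y - z‖ ^ 2 / 2 by positivity)))
    rw [← EReal.coe_add]
    congr 1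
    ring

/-- The Moreau envelope has the same minimizers as the function. -/
lemma HasProx.argmin_infConv {f : E → EReal} (h : HasProx f) :
    Argmin (infConv f (halfSq E)) = Argmin f := by
  ext x
  obtain ⟨p, a, hp⟩ := h x
  rw [hp.mem_argmin_infConv_iff, hp.mem_argmin_iff]

lemma HasProx.argmin_eq_fixedPoints {f : E → EReal} (h : HasProx f) :
    Argmin f = Function.fixedPoints (prox f) := by
  ext x
  obtain ⟨p, a, hp⟩ := h x
  rw [hp.mem_argmin_iff, Function.mem_fixedPoints, Function.IsFixedPt, hp.prox_eq]

end Subgradient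

/-! ### Proximal composition and cocomposition -/

section ProxComp

variable {H G : Type*}
  [NormedAddCommGroup H] [InnerProductSpace ℝ H] [CompleteSpace H]
  [NormedAddCommGroup G] [InnerProductSpace ℝ G] [CompleteSpace G]

omit [CompleteSpace H] [CompleteSpace G] in
lemma norm_apply_le_of_norm_le_one {L : H →L[ℝ] G} (hL : ‖L‖ ≤ 1) (x : H) : ‖L x‖ ≤ ‖x‖ :=
  (L.le_of_opNorm_le hL x).trans_eq (one_mul _)

/-- Subgradients of `(g* □ Q) ∘ L`. -/
lemma IsSubgradientAt.infConv_conj_comp {g : G → EReal} (hg : HasProx g) (L : H →L[ℝ] G) {x : H}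
    {p : G} {a : ℝ} (h : IsSubgradientAt g p (L x - p) a) :
    IsSubgradientAt (infConv (HilbertConvex.conj g) (halfSq G) ∘ L) x (L.adjoint p)
      (inner ℝ p (L x) - ‖p‖ ^ 2 / 2 - a) := by
  refine ⟨h.infConv_conj_halfSq, fun y => ?_⟩
  obtain ⟨q, b, hq⟩ := hg (L y)
  rw [Function.comp_apply, hq.infConv_conj_halfSq, EReal.coe_le_coe_iff,
    ContinuousLinearMap.adjoint_inner_right, map_sub]
  have := hq.coe_le p h.1.le
  have h2 := sq_nonneg ‖p - q‖
  rw [norm_sub_sq_real] at h2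
  simp only [inner_sub_left, inner_sub_right, real_inner_self_eq_norm_sq] at this ⊢
  rw [real_inner_comm p (L x), real_inner_comm p (L y)]
  linarith

lemma IsSubgradientAt.proxComp {g : G → EReal} (hg : HasProx g) {L : H →L[ℝ] G} (hL : ‖L‖ ≤ 1)
    {x : H} {p : G} {a : ℝ} (h : IsSubgradientAt g p (L x - p) a) :
    IsSubgradientAt (proxComp L g) (L.adjoint p) (x - L.adjoint p)
      (‖p‖ ^ 2 / 2 + a - ‖L.adjoint p‖ ^ 2 / 2) := by
  have hc := (h.infConv_conj_comp hg L).conj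
  refine ⟨?_, fun z => ?_⟩
  · rw [HilbertConvex.proxComp, Pi.sub_apply, hc.1, halfSq, ← EReal.coe_sub,
      ContinuousLinearMap.adjoint_inner_right, real_inner_comm]
    congr 1
    ring
  · obtain ⟨d, rfl⟩ : ∃ d, z = d + L.adjoint p := ⟨z - L.adjoint p, by abel⟩
    obtain ⟨q, b, hq⟩ := hg (L (x + d))
    have hle : ((inner ℝ (x + d) (d + L.adjoint p)
        - (inner ℝ q (L (x + d)) - ‖q‖ ^ 2 / 2 - b) : ℝ) : EReal) ≤
        HilbertConvex.conj (infConv (HilbertConvex.conj g) (halfSq G) ∘ L) (d + L.adjoint p) := by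
      refine le_trans (le_of_eq ?_) (le_iSup _ (x + d))
      rw [Function.comp_apply, hq.infConv_conj_halfSq, EReal.coe_sub]
    refine le_trans ?_ (EReal.sub_le_sub hle (le_refl (halfSq H _)))
    rw [halfSq, ← EReal.coe_sub, EReal.coe_le_coe_iff]
    have h1 := h.coe_le q hq.1.le
    -- With `h3`, this bounds `⟪L d, q - p⟫ - ‖q - p‖² / 2` by `‖d‖² / 2`; only here does `‖L‖ ≤ 1`
    -- enter.
    have h2 := sq_nonneg ‖L d - (q - p)‖
    have h3 : ‖L d‖ ^ 2 ≤ ‖d‖ ^ 2 := by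
      gcongr
      exact norm_apply_le_of_norm_le_one hL d
    rw [norm_sub_sq_real, norm_sub_sq_real] at h2
    rw [norm_add_sq_real, map_add, add_sub_cancel_right]
    simp only [inner_sub_left, inner_sub_right, inner_add_left, inner_add_right,
      real_inner_self_eq_norm_sq, ContinuousLinearMap.adjoint_inner_right, map_add] at h1 h2 ⊢
    rw [real_inner_comm (L d) q, real_inner_comm p (L x), real_inner_comm x d]
    linarith

lemma HasProx.proxComp {g : G → EReal} (hg : HasProx g) {L : H →L[ℝ] G} (hL : ‖L‖ ≤ 1) :
    HasProx (proxComp L g) := fun x => by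
  obtain ⟨p, a, hp⟩ := hg (L x)
  exact ⟨_, _, hp.proxComp hg hL⟩

lemma HasProx.prox_proxComp {g : G → EReal} (hg : HasProx g) {L : H →L[ℝ] G} (hL : ‖L‖ ≤ 1) :
    prox (HilbertConvex.proxComp L g) = L.adjoint ∘ prox g ∘ L := by
  funext x
  obtain ⟨p, a, hp⟩ := hg (L x)
  rw [(hp.proxComp hg hL).prox_eq, Function.comp_apply, Function.comp_apply, hp.prox_eq]

lemma HasProx.infConv_proxComp {g : G → EReal} (hg : HasProx g) {L : H →L[ℝ] G} (hL : ‖L‖ ≤ 1) :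
    infConv (HilbertConvex.proxComp L g) (halfSq H) =
      halfSq H - infConv (HilbertConvex.conj g) (halfSq G) ∘ L := by
  funext x
  obtain ⟨p, a, hp⟩ := hg (L x)
  rw [(hp.proxComp hg hL).infConv_halfSq, Pi.sub_apply, Function.comp_apply,
    hp.infConv_conj_halfSq, halfSq, ← EReal.coe_sub, norm_sub_sq_real,
    ContinuousLinearMap.adjoint_inner_right, real_inner_comm]
  congr 1
  ring

lemma HasProx.infConv_proxCocomp {g : G → EReal} (hg : HasProx g) {L : H →L[ℝ] G}
    (hL : ‖L‖ ≤ 1) :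
    infConv (proxCocomp L g) (halfSq H) = infConv g (halfSq G) ∘ L := by
  rw [proxCocomp, (hg.conj.proxComp hL).infConv_conj, hg.conj.infConv_proxComp hL,
    hg.infConv_conj_conj]
  funext x
  obtain ⟨r, hr⟩ := hg.exists_infConv_eq (L x)
  rw [Pi.sub_apply, Pi.sub_apply, Function.comp_apply, hr, halfSq, ← EReal.coe_sub,
    ← EReal.coe_sub, sub_sub_cancel]

end ProxComp

/-! ### Existence of minimizers and Fermat's rule in `Γ₀` -/

section GammaZero

variable {E F : Type*}
  [NormedAddCommGroup E] [InnerProductSpace ℝ E]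
  [NormedAddCommGroup F] [InnerProductSpace ℝ F]

lemma IsGammaZero.le_of_convex_comb {f : E → EReal} (hf : IsGammaZero f) {x z : E} {α β : ℝ}
    (hx : f x ≤ (α : EReal)) (hz : f z ≤ (β : EReal)) {s t : ℝ} (hs : 0 ≤ s) (ht : 0 ≤ t)
    (hst : s + t = 1) : f (s • x + t • z) ≤ ((s * α + t * β : ℝ) : EReal) :=
  hf.convex (show (x, α) ∈ epigraph f from hx) (show (z, β) ∈ epigraph f from hz) hs ht hst

lemma IsGammaZero.le_of_tendsto {f : E → EReal} (hf : IsGammaZero f) {v : ℕ → E} {α : ℕ → ℝ}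
    {x : E} {a : ℝ} (hv : Tendsto v atTop (𝓝 x)) (hα : Tendsto α atTop (𝓝 a))
    (h : ∀ n, f (v n) ≤ (α n : EReal)) : f x ≤ (a : EReal) := by
  have hc := lowerSemicontinuous_iff_isClosed_epigraph.1 hf.lsc
  have ht : Tendsto (fun n => (v n, (α n : EReal))) atTop (𝓝 (x, (a : EReal))) :=
    hv.prodMk_nhds ((continuous_coe_real_ereal.tendsto a).comp hα)
  exact hc.mem_of_tendsto ht (Eventually.of_forall h)

lemma IsGammaZero.exists_eq_coe {f : E → EReal} (hf : IsGammaZero f) {x : E} (hx : f x ≠ ⊤) :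
    ∃ a : ℝ, f x = (a : EReal) :=
  ⟨(f x).toReal, (EReal.coe_toReal hx (hf.proper.1 x)).symm⟩

/-- A function in `Γ₀(E)` decreases at most linearly. -/
lemma IsGammaZero.exists_lower_bound {f : E → EReal} (hf : IsGammaZero f) :
    ∃ (x₀ : E) (c M : ℝ), 0 ≤ c ∧
      ∀ (v : E) (α : ℝ), f v ≤ (α : EReal) → M - c * ‖v - x₀‖ ≤ α := by
  obtain ⟨x₀, hx₀⟩ := hf.proper.2
  obtain ⟨a, ha⟩ := hf.exists_eq_coe (ne_of_lt hx₀)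
  have hlt : ((a - 1 : ℝ) : EReal) < f x₀ := by
    rw [ha, EReal.coe_lt_coe_iff]
    linarith
  obtain ⟨ε, hε, hball⟩ := Metric.eventually_nhds_iff.1 (hf.lsc x₀ _ hlt)
  refine ⟨x₀, 2 / ε, a - 1, by positivity, fun v α hv => ?_⟩
  rcases lt_or_ge ‖v - x₀‖ ε with hd | hd
  · have h1 := (hball (by rwa [dist_eq_norm])).trans_le hv
    rw [EReal.coe_lt_coe_iff] at h1
    have : 0 ≤ 2 / ε * ‖v - x₀‖ := by positivity
    linarith
  · have hpos : 0 < ‖v - x₀‖ := hε.trans_le hd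
    -- Puts the convex combination at distance `ε / 2` from `x₀`, inside the ball where `f > a - 1`.
    obtain ⟨t, ht⟩ : ∃ t, t = ε / (2 * ‖v - x₀‖) := ⟨_, rfl⟩
    have ht0 : 0 < t := by rw [ht]; positivity
    have ht1 : t ≤ 1 := by
      rw [ht, div_le_one (by positivity)]
      linarith
    have htd : t * ‖v - x₀‖ = ε / 2 := by
      rw [ht]
      field_simp
    have h1 := hf.le_of_convex_comb ha.le hv (sub_nonneg.2 ht1) ht0.le (sub_add_cancel 1 t)
    have h2 : ((a - 1 : ℝ) : EReal) < f ((1 - t) • x₀ + t • v) := by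
      refine hball ?_
      have : (1 - t) • x₀ + t • v - x₀ = t • (v - x₀) := by module
      rw [dist_eq_norm, this, norm_smul, Real.norm_of_nonneg ht0.le, htd]
      linarith
    have h3 := h2.trans_le h1
    rw [EReal.coe_lt_coe_iff] at h3
    have h4 : t * (2 / ε * ‖v - x₀‖) = 1 := by
      rw [mul_left_comm, htd]
      field_simp
    have h5 : 0 < t * (α - (a - 2 / ε * ‖v - x₀‖)) := by
      rw [mul_sub, mul_sub, h4]
      linarith
    have := pos_of_mul_pos_right h5 ht0.le
    linarith

lemma nonneg_of_forall_mul_add_sq_mul {A C : ℝ}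
    (h : ∀ t : ℝ, 0 ≤ t → t ≤ 1 → 0 ≤ t * A + t ^ 2 * C) : 0 ≤ A := by
  by_contra! hA
  have hD : 0 < |C| + 1 - A := by linarith [abs_nonneg C]
  obtain ⟨t, ht⟩ : ∃ t, t = -A / (|C| + 1 - A) := ⟨_, rfl⟩
  have ht0 : 0 < t := by
    rw [ht]
    exact div_pos (by linarith) hD
  have htD : t * (|C| + 1 - A) = -A := by
    rw [ht]
    field_simp
  have ht1 : t ≤ 1 := by
    rw [ht, div_le_one hD]
    linarith [abs_nonneg C]
  have h1 := h t ht0.le ht1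
  have h2 : 0 ≤ t * (A + t * C) := by linarith
  have h3 := nonneg_of_mul_nonneg_right h2 ht0
  have h4 : t * C ≤ t * |C| := mul_le_mul_of_nonneg_left (le_abs_self C) ht0.le
  nlinarith

lemma norm_add_smul_sq_real (u d : E) (t : ℝ) :
    ‖u + t • d‖ ^ 2 = ‖u‖ ^ 2 + 2 * t * inner ℝ d u + t ^ 2 * ‖d‖ ^ 2 := by
  rw [norm_add_sq_real, inner_smul_right, norm_smul, mul_pow, Real.norm_eq_abs, sq_abs,
    real_inner_comm]
  ring

lemma norm_midpoint_sub_sq (u v w : E) :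
    ‖(1 / 2 : ℝ) • u + (1 / 2 : ℝ) • v - w‖ ^ 2 =
      (‖u - w‖ ^ 2 + ‖v - w‖ ^ 2) / 2 - ‖u - v‖ ^ 2 / 4 := by
  have h1 : (1 / 2 : ℝ) • u + (1 / 2 : ℝ) • v - w = (1 / 2 : ℝ) • ((u - w) + (v - w)) := by module
  have h2 : u - v = (u - w) - (v - w) := by abel
  rw [h1, h2, norm_smul, mul_pow, norm_add_sq_real (u - w), norm_sub_sq_real (u - w)]
  norm_num
  ring

variable [CompleteSpace E] [CompleteSpace F]

/-- Minimizers of a function in `Γ₀(E)` plus a coercive quadratic function exist and satisfy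
Fermat's rule. -/
lemma IsGammaZero.exists_isSubgradientAt {f : E → EReal} (hf : IsGammaZero f) (T : E →L[ℝ] F)
    {k : ℝ} (hk : 0 ≤ k) (y : E) (w : F) :
    ∃ p a, IsSubgradientAt f p (y - p + k • T.adjoint (w - T p)) a := by
  obtain ⟨r, hr⟩ : ∃ r : E → ℝ, r = fun v => ‖v - y‖ ^ 2 / 2 + k / 2 * ‖T v - w‖ ^ 2 := ⟨_, rfl⟩
  have hrc : Continuous r := by
    rw [hr]
    fun_prop
  -- Minimizing over the epigraph keeps the infimum real.
  obtain ⟨S, hS⟩ : ∃ S : Set ℝ, S = {s | ∃ v α, f v ≤ ((α : ℝ) : EReal) ∧ s = α + r v} := ⟨_, rfl⟩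
  have hne : S.Nonempty := by
    obtain ⟨x, hx⟩ := hf.proper.2
    obtain ⟨a, ha⟩ := hf.exists_eq_coe (ne_of_lt hx)
    rw [hS]
    exact ⟨_, x, a, ha.le, rfl⟩
  have hbdd : BddBelow S := by
    obtain ⟨x₀, c, M, hc, hM⟩ := hf.exists_lower_bound
    refine ⟨M - c * ‖y - x₀‖ - c ^ 2 / 2, ?_⟩
    rw [hS]
    rintro s ⟨v, α, hv, rfl⟩
    have h1 := hM v α hv
    have h2 : c * ‖v - x₀‖ ≤ c * (‖v - y‖ + ‖y - x₀‖) :=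
      mul_le_mul_of_nonneg_left (norm_sub_le_norm_sub_add_norm_sub v y x₀) hc
    have h3 : 0 ≤ k / 2 * ‖T v - w‖ ^ 2 := by positivity
    rw [hr]
    nlinarith [sq_nonneg (‖v - y‖ - c)]
  obtain ⟨m, hm⟩ : ∃ m, m = sInf S := ⟨_, rfl⟩
  have hmle : ∀ v (α : ℝ), f v ≤ (α : EReal) → m ≤ α + r v := fun v α hv => by
    rw [hm]
    refine csInf_le hbdd ?_
    rw [hS]
    exact ⟨v, α, hv, rfl⟩
  have hex : ∀ n : ℕ, ∃ v α, f v ≤ ((α : ℝ) : EReal) ∧ α + r v < m + 1 / ((n : ℝ) + 1) := fun n => by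
    obtain ⟨s, hs, hlt⟩ := exists_lt_of_csInf_lt hne
      (show sInf S < m + 1 / ((n : ℝ) + 1) by rw [← hm]; linarith [Nat.one_div_pos_of_nat (α := ℝ) (n := n)])
    rw [hS] at hs
    obtain ⟨v, α, hv, rfl⟩ := hs
    exact ⟨v, α, hv, hlt⟩
  choose v α hvα hlt using hex
  -- The parallelogram identity at midpoints makes minimizing sequences Cauchy.
  have hmid : ∀ i j, ‖v i - v j‖ ^ 2 / 8 ≤ (α i + r (v i) + (α j + r (v j))) / 2 - m := fun i j => by
    have h1 := hmle _ _ (hf.le_of_convex_comb (hvα i) (hvα j) (s := 1 / 2) (t := 1 / 2)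
      (by norm_num) (by norm_num) (by norm_num))
    simp only [hr] at h1 ⊢
    rw [map_add, map_smul, map_smul, norm_midpoint_sub_sq, norm_midpoint_sub_sq] at h1
    have h2 : 0 ≤ k / 2 * (‖T (v i) - T (v j)‖ ^ 2 / 4) := by positivity
    linarith
  have htend := tendsto_one_div_add_atTop_nhds_zero_nat (𝕜 := ℝ)
  have hcauchy : CauchySeq v := by
    refine cauchySeq_of_le_tendsto_0' (fun n : ℕ => √(8 * (1 / ((n : ℝ) + 1)))) (fun n l hnl => ?_) ?_
    · rw [dist_eq_norm]
      refine Real.le_sqrt_of_sq_le ?_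
      have h1 := hmid n l
      have h2 := hlt n
      have h3 := hlt l
      have h4 : 1 / ((l : ℝ) + 1) ≤ 1 / ((n : ℝ) + 1) := by gcongr
      linarith
    · simpa using (htend.const_mul 8).sqrt
  obtain ⟨p, hp⟩ := cauchySeq_tendsto_of_complete hcauchy
  have hrp : Tendsto (fun n => r (v n)) atTop (𝓝 (r p)) := (hrc.tendsto p).comp hp
  have hfp : f p ≤ ((m - r p : ℝ) : EReal) := by
    have ht : Tendsto (fun n : ℕ => m + 1 / ((n : ℝ) + 1) - r (v n)) atTop (𝓝 (m - r p)) := by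
      simpa using (htend.const_add m).sub hrp
    refine hf.le_of_tendsto hp ht fun n => (hvα n).trans ?_
    rw [EReal.coe_le_coe_iff]
    linarith [hlt n]
  obtain ⟨a, ha⟩ := hf.exists_eq_coe (ne_top_of_le_ne_top (EReal.coe_ne_top _) hfp)
  have ham : m = a + r p := by
    refine le_antisymm (hmle p a ha.le) ?_
    rw [ha, EReal.coe_le_coe_iff] at hfp
    linarith
  refine ⟨p, a, ha, fun z => ?_⟩
  rcases eq_or_ne (f z) ⊤ with hz | hz
  · rw [hz]
    exact le_top
  obtain ⟨β, hβ⟩ := hf.exists_eq_coe hz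
  rw [hβ, EReal.coe_le_coe_iff]
  obtain ⟨d, rfl⟩ : ∃ d, z = p + d := ⟨z - p, by abel⟩
  -- First-order optimality along the segment from `p` to `p + d`.
  have key : 0 ≤ β - a + (inner ℝ d (p - y) + k * inner ℝ (T d) (T p - w)) := by
    refine nonneg_of_forall_mul_add_sq_mul (C := ‖d‖ ^ 2 / 2 + k / 2 * ‖T d‖ ^ 2) fun t ht0 ht1 => ?_
    have h1 := hmle _ _ (hf.le_of_convex_comb ha.le hβ.le (sub_nonneg.2 ht1) ht0
      (sub_add_cancel 1 t))
    have h2 : (1 - t) • p + t • (p + d) = p + t • d := by module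
    have h3 : p + t • d - y = (p - y) + t • d := by abel
    have h4 : T p + t • T d - w = (T p - w) + t • T d := by abel
    rw [ham, h2] at h1
    simp only [hr] at h1
    rw [h3, map_add, map_smul, h4, norm_add_smul_sq_real, norm_add_smul_sq_real] at h1
    linarith
  rw [add_sub_cancel_left, inner_add_right, inner_smul_right,
    ContinuousLinearMap.adjoint_inner_right, ← neg_sub p y, ← neg_sub (T p) w, inner_neg_right,
    inner_neg_right]
  linarith

lemma IsGammaZero.hasProx {f : E → EReal} (hf : IsGammaZero f) : HasProx f := fun x => by
  simpa using hf.exists_isSubgradientAt (0 : E →L[ℝ] E) le_rfl x 0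

end GammaZero

/-! ### Infimal postcomposition, exactness and domain -/

section Postcomp

lemma postcomp_le {E F : Type*} [NormedAddCommGroup E] [InnerProductSpace ℝ E]
    [NormedAddCommGroup F] [InnerProductSpace ℝ F] {T : E →L[ℝ] F} {f : E → EReal} {x : E} {y : F}
    (h : T x = y) : postcomp T f y ≤ f x :=
  iInf₂_le x h

variable {H G : Type*}
  [NormedAddCommGroup H] [InnerProductSpace ℝ H] [CompleteSpace H]
  [NormedAddCommGroup G] [InnerProductSpace ℝ G] [CompleteSpace G]

lemma HasProx.conj_comp_le {g : G → EReal} (hg : HasProx g) (L : H →L[ℝ] G) (v : G) :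
    HilbertConvex.conj (infConv (HilbertConvex.conj g) (halfSq G) ∘ L) (L.adjoint v) ≤ g v + halfSq G v := by
  refine iSup_le fun u => ?_
  obtain ⟨p, a, hp⟩ := hg (L u)
  rw [Function.comp_apply, hp.infConv_conj_halfSq, ← EReal.coe_sub]
  refine le_trans ?_ (add_le_add_left (hp.2 v) _)
  rw [halfSq, ← EReal.coe_add, EReal.coe_le_coe_iff, ContinuousLinearMap.adjoint_inner_right]
  have h := sq_nonneg ‖v - p‖
  rw [norm_sub_sq_real] at h
  simp only [inner_sub_left, inner_sub_right, real_inner_self_eq_norm_sq]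
  rw [real_inner_comm v (L u)]
  linarith

/-- The sublevel sets of the biconjugate are reached by the postcomposition. -/
lemma IsGammaZero.exists_adjoint_eq {g : G → EReal} (hg : IsGammaZero g) (L : H →L[ℝ] G) {y : H}
    {α : ℝ} (h : conj (infConv (HilbertConvex.conj g) (halfSq G) ∘ L) y ≤ (α : EReal)) :
    ∃ v, L.adjoint v = y ∧ g v + halfSq G v ≤ (α : EReal) := by
  -- Optimality condition for minimizing `g + Q + (n / 2) ‖L* · - y‖²`; `μ n` below is the minimum.
  have hex : ∀ n : ℕ, ∃ p a,
      IsSubgradientAt g p (L ((n : ℝ) • (y - L.adjoint p)) - p) a := fun n => by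
    obtain ⟨p, a, hp⟩ := hg.exists_isSubgradientAt L.adjoint n.cast_nonneg 0 y
    refine ⟨p, a, ?_⟩
    rwa [ContinuousLinearMap.adjoint_adjoint, zero_sub, neg_add_eq_sub, ← map_smul] at hp
  choose v a hv using hex
  obtain ⟨A, hA⟩ : ∃ A : ℕ → H, A = fun n => y - L.adjoint (v n) := ⟨_, rfl⟩
  obtain ⟨μ, hμ⟩ : ∃ μ : ℕ → ℝ,
    μ = fun n => a n + ‖v n‖ ^ 2 / 2 + (n : ℝ) / 2 * ‖A n‖ ^ 2 := ⟨_, rfl⟩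
  -- The conjugate is tested at the multiplier `n • (y - L* (v n))`.
  have hle : ∀ n, μ n ≤ α := fun n => by
    have h1 := (le_iSup _ ((n : ℝ) • A n)).trans h
    have h2 := hv n
    rw [← congrFun hA n] at h2
    rw [Function.comp_apply, h2.infConv_conj_halfSq, ← EReal.coe_sub, EReal.coe_le_coe_iff,
      map_smul, inner_smul_right, inner_smul_left, ← ContinuousLinearMap.adjoint_inner_left] at h1
    have h3 : L.adjoint (v n) = y - A n := by simp [hA]
    rw [h3, inner_sub_left, real_inner_self_eq_norm_sq, real_inner_comm y] at h1
    have h4 : 0 ≤ (n : ℝ) / 2 * ‖A n‖ ^ 2 := by positivity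
    simp only [conj_trivial] at h1
    simp only [hμ]
    linarith
  -- Strong convexity of the `k`-th problem, and penalties increasing with the index. As `μ` is
  -- bounded, `v` is Cauchy.
  have hgrow : ∀ k l : ℕ, k ≤ l → μ k + ‖v l - v k‖ ^ 2 / 2 ≤ μ l := fun k l hkl => by
    have h1 := (hv k).coe_le _ (hv l).1.le
    rw [← congrFun hA k, inner_sub_right, ← ContinuousLinearMap.adjoint_inner_left, map_sub] at h1
    have h3 : L.adjoint (v l) - L.adjoint (v k) = A k - A l := by simp [hA]
    rw [h3, inner_smul_right] at h1
    simp only [hμ]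
    have h4 : 0 ≤ (k : ℝ) / 2 * ‖A k - A l‖ ^ 2 := by positivity
    have h5 : (k : ℝ) / 2 * ‖A l‖ ^ 2 ≤ (l : ℝ) / 2 * ‖A l‖ ^ 2 := by gcongr
    rw [norm_sub_sq_real] at h4 ⊢
    simp only [inner_sub_left, real_inner_self_eq_norm_sq] at h1
    rw [real_inner_comm (A k) (A l)] at h1
    linarith
  have hmono : Monotone μ := fun k l hkl => by
    have := hgrow k l hkl
    have := sq_nonneg ‖v l - v k‖
    linarith
  have hbdd : BddAbove (Set.range μ) := ⟨α, by rintro _ ⟨n, rfl⟩; exact hle n⟩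
  have hlim := tendsto_atTop_ciSup hmono hbdd
  have hcauchy : CauchySeq v := by
    refine cauchySeq_of_le_tendsto_0' (fun n => √(2 * ((⨆ i, μ i) - μ n))) (fun k l hkl => ?_) ?_
    · rw [dist_comm, dist_eq_norm]
      refine Real.le_sqrt_of_sq_le ?_
      linarith [hgrow k l hkl, le_ciSup hbdd l]
    · simpa using ((hlim.const_sub (⨆ i, μ i)).const_mul 2).sqrt
  obtain ⟨p, hp⟩ := cauchySeq_tendsto_of_complete hcauchy
  have hAlim : Tendsto (fun n => ‖A n‖ ^ 2) atTop (𝓝 (‖y - L.adjoint p‖ ^ 2)) := by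
    have hc : Continuous fun v => ‖y - L.adjoint v‖ ^ 2 := by fun_prop
    rw [hA]
    exact (hc.tendsto p).comp hp
  -- `μ 0` is the unpenalized minimum, so the penalty in `μ n` is at most `α - μ 0`; hence `A n →
  -- 0`.
  have hAle : ∀ n : ℕ, (n : ℝ) * ‖A n‖ ^ 2 ≤ 2 * (α - μ 0) := fun n => by
    have h1 := (hv 0).coe_le _ (hv n).1.le
    have h2 := hle n
    have h3 := sq_nonneg ‖v n - v 0‖
    rw [norm_sub_sq_real] at h3
    simp only [hμ, Nat.cast_zero, zero_smul, map_zero, zero_sub, inner_neg_right, inner_sub_left,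
      real_inner_self_eq_norm_sq, zero_div, zero_mul] at h1 h2 ⊢
    linarith
  have hA0 : Tendsto (fun n => ‖A n‖ ^ 2) atTop (𝓝 0) := by
    refine tendsto_of_tendsto_of_tendsto_of_le_of_le' tendsto_const_nhds
      (tendsto_const_div_atTop_nhds_zero_nat (2 * (α - μ 0)))
      (Eventually.of_forall fun n => by positivity) ?_
    filter_upwards [eventually_gt_atTop 0] with n hn
    rw [le_div_iff₀ (by exact_mod_cast hn), mul_comm]
    exact hAle n
  have hz : y - L.adjoint p = 0 := by
    have := tendsto_nhds_unique hAlim hA0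
    simpa using this
  refine ⟨p, (sub_eq_zero.1 hz).symm, ?_⟩
  have hgp : g p ≤ ((α - ‖p‖ ^ 2 / 2 : ℝ) : EReal) := by
    have hc : Continuous fun v : G => α - ‖v‖ ^ 2 / 2 := by fun_prop
    refine hg.le_of_tendsto hp ((hc.tendsto p).comp hp) fun n => ?_
    rw [(hv n).1, EReal.coe_le_coe_iff, Function.comp_apply]
    have h1 := hle n
    have h2 : 0 ≤ (n : ℝ) / 2 * ‖A n‖ ^ 2 := by positivity
    simp only [hμ] at h1
    linarith
  refine (add_le_add_left hgp _).trans_eq ?_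
  rw [halfSq, ← EReal.coe_add, sub_add_cancel]

lemma IsGammaZero.conj_comp_eq_postcomp {g : G → EReal} (hg : IsGammaZero g) (L : H →L[ℝ] G) :
    conj (infConv (HilbertConvex.conj g) (halfSq G) ∘ L) =
      postcomp L.adjoint (g + halfSq G) := by
  funext y
  refine le_antisymm (le_iInf₂ fun v hv => ?_) (EReal.le_of_forall_lt_iff_le.1 fun α hα => ?_)
  · rw [← show L.adjoint v = y from hv]
    exact hg.hasProx.conj_comp_le L v
  · obtain ⟨v, hv, hle⟩ := hg.exists_adjoint_eq L hα.le
    exact iInf₂_le_of_le v hv hle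

lemma IsGammaZero.isExactPostcomp {g : G → EReal} (hg : IsGammaZero g) (L : H →L[ℝ] G) :
    IsExactPostcomp L.adjoint (g + halfSq G) := by
  have hbot : ∀ v, (g + halfSq G) v ≠ ⊥ := fun v => by
    rw [Pi.add_apply, Ne, EReal.add_eq_bot_iff]
    simp [hg.proper.1 v, halfSq]
  rintro _ ⟨v, hv, rfl⟩
  have htop : postcomp L.adjoint (g + halfSq G) (L.adjoint v) ≠ ⊤ :=
    ne_top_of_le_ne_top (ne_of_lt hv) (postcomp_le rfl)
  -- A subgradient at `0` of the function being conjugated gives an affine minorant of the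
  -- conjugate. The value is thus real and can serve as `α`.
  have hnbot : postcomp L.adjoint (g + halfSq G) (L.adjoint v) ≠ ⊥ := by
    obtain ⟨p, a, hp⟩ := hg.hasProx (L 0)
    rw [← hg.conj_comp_eq_postcomp]
    exact ne_bot_of_le_ne_bot (EReal.coe_ne_bot _)
      ((hp.infConv_conj_comp hg.hasProx L).conj.2 (L.adjoint v))
  have hα := EReal.coe_toReal htop hnbot
  obtain ⟨w, hw, hle⟩ := hg.exists_adjoint_eq L (y := L.adjoint v)
    (by rw [hg.conj_comp_eq_postcomp]; exact hα.ge)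
  refine ⟨w, hw, le_antisymm (postcomp_le hw) ?_, hbot w⟩
  rw [← hα]
  exact hle

lemma IsGammaZero.proxComp_eq_postcomp {g : G → EReal} (hg : IsGammaZero g) (L : H →L[ℝ] G) :
    proxComp L g = postcomp L.adjoint (g + halfSq G) - halfSq H := by
  rw [proxComp, hg.conj_comp_eq_postcomp]

lemma IsGammaZero.dom_proxComp {g : G → EReal} (hg : IsGammaZero g) (L : H →L[ℝ] G) :
    dom (proxComp L g) = L.adjoint '' dom g := by
  ext y
  rw [hg.proxComp_eq_postcomp]
  have h1 : ∀ (e : EReal) (r : ℝ), e - (r : EReal) < ⊤ ↔ e < ⊤ := fun e r => by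
    induction e <;> simp [← EReal.coe_sub, EReal.coe_lt_top]
  have h2 : ∀ (e : EReal) (r : ℝ), e + (r : EReal) < ⊤ ↔ e < ⊤ := fun e r => by
    induction e <;> simp [← EReal.coe_add, EReal.coe_lt_top]
  simp only [dom, Set.mem_ofPred_eq, Pi.sub_apply, halfSq, h1, postcomp, iInf_lt_iff, Pi.add_apply,
    h2, Set.mem_image, Set.mem_preimage, Set.mem_singleton_iff, exists_prop]
  exact exists_congr fun v => and_comm

end Postcomp

end HilbertConvex

end

theorem theorem5p4 {H G : Type*}
    [NormedAddCommGroup H] [InnerProductSpace ℝ H] [CompleteSpace H]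
    [NormedAddCommGroup G] [InnerProductSpace ℝ G] [CompleteSpace G]
    (L : H →L[ℝ] G) (hL0 : 0 < ‖L‖) (hL1 : ‖L‖ ≤ 1)
    (g : G → EReal) (hg : HilbertConvex.IsGammaZero g) :
    -- the objects below are well defined: the functions are proper, with values in `]-∞, +∞]`,
    -- and `prox g y` is the unique minimizer of `z ↦ g z + ‖y - z‖² / 2`
    (HilbertConvex.IsProper (HilbertConvex.proxComp L g) ∧
      HilbertConvex.IsProper (HilbertConvex.proxCocomp L g) ∧
      HilbertConvex.IsProper (HilbertConvex.infConv g (HilbertConvex.halfSq G) ∘ L) ∧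
      ∀ y, HilbertConvex.Argmin (HilbertConvex.proxObjective g y) = {HilbertConvex.prox g y}) ∧
    -- infimal postcomposition formula, with exactness
    (HilbertConvex.IsExactPostcomp L.adjoint (g + HilbertConvex.halfSq G) ∧
      HilbertConvex.proxComp L g =
        HilbertConvex.postcomp L.adjoint (g + HilbertConvex.halfSq G) -
          HilbertConvex.halfSq H) ∧
    -- domain
    HilbertConvex.dom (HilbertConvex.proxComp L g) = L.adjoint '' HilbertConvex.dom g ∧
    -- minimizers of the proximal composition
    HilbertConvex.Argmin (HilbertConvex.proxComp L g) =
      Function.fixedPoints (L.adjoint ∘ HilbertConvex.prox g ∘ L) ∧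
    -- Moreau envelope of the proximal composition
    HilbertConvex.infConv (HilbertConvex.proxComp L g) (HilbertConvex.halfSq H) =
      HilbertConvex.halfSq H -
        HilbertConvex.infConv (HilbertConvex.conj g) (HilbertConvex.halfSq G) ∘ L ∧
    -- Moreau envelope of the proximal cocomposition
    HilbertConvex.infConv (HilbertConvex.proxCocomp L g) (HilbertConvex.halfSq H) =
      HilbertConvex.infConv g (HilbertConvex.halfSq G) ∘ L ∧
    -- minimizers of the proximal cocomposition
    L ⁻¹' HilbertConvex.Argmin g ⊆ HilbertConvex.Argmin (HilbertConvex.proxCocomp L g) ∧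
    HilbertConvex.Argmin (HilbertConvex.proxCocomp L g) =
      HilbertConvex.Argmin (HilbertConvex.infConv g (HilbertConvex.halfSq G) ∘ L) := by
  have hp := hg.hasProx
  have hc : HilbertConvex.HasProx (HilbertConvex.proxCocomp L g) := (hp.conj.proxComp hL1).conj
  have hargmin : HilbertConvex.Argmin (HilbertConvex.proxCocomp L g) =
      HilbertConvex.Argmin (HilbertConvex.infConv g (HilbertConvex.halfSq G) ∘ L) := by
    rw [← hc.argmin_infConv, hp.infConv_proxCocomp hL1]
  refine ⟨⟨(hp.proxComp hL1).isProper, hc.isProper, ⟨fun x => ?_, 0, ?_⟩, fun y => ?_⟩,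
    ⟨hg.isExactPostcomp L, hg.proxComp_eq_postcomp L⟩, hg.dom_proxComp L, ?_,
    hp.infConv_proxComp hL1, hp.infConv_proxCocomp hL1, fun x hx => ?_, hargmin⟩
  · obtain ⟨r, hr⟩ := hp.exists_infConv_eq (L x)
    rw [Function.comp_apply, hr]
    exact EReal.coe_ne_bot r
  · obtain ⟨r, hr⟩ := hp.exists_infConv_eq (L 0)
    rw [HilbertConvex.dom, Set.mem_ofPred_eq, Function.comp_apply, hr]
    exact EReal.coe_lt_top r
  · obtain ⟨p, a, h⟩ := hp y
    rw [h.prox_eq, h.argmin_proxObjective]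
  · rw [(hp.proxComp hL1).argmin_eq_fixedPoints, hp.prox_proxComp hL1]
  · rw [hargmin]
    rw [Set.mem_preimage, ← hp.argmin_infConv] at hx
    exact fun z => hx (L z)
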